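/- **Setting (restricted Gaussian Y-channel).** Three users $1,2,3$ communicate through a relay over real, reciprocal channels with gains $h_1,h_2,h_3\in\mathbb{R}$ and power $P\ge 0$. Put $C(x)=\frac12\log_2(1+x)$. For a tuple $\vec R=(R_{jk})_{j\neq k}$ of six nonnegative rates, a restricted code of length $n$ consists of the following. The messages $m_{jk}$ (from user $j$ to user $k$, $j\ne k$) are independent and $m_{jk}$ is uniform on the integers $m$ with $1\le m\le 2^{nR_{jk}}$. With restricted encoding, user $j$ sends $x_j^n=f_j\big((m_{jk})_{k\neq j}\big)$, which depends on its own two messages only. At time $i=1,\dots,n$ the relay receives $y_{ri}=h_1x_{1i}+h_2x_{2i}+h_3x_{3i}+z_{ri}$ and sends $x_{ri}=f_{ri}(y_{r1},\dots,y_{r,i-1})$, and user $j$ receives $y_{ji}=h_jx_{ri}+z_{ji}$. All noise samples $z_{ri},z_{1i},z_{2i},z_{3i}$ are standard Gaussian, independent of one another and of the messages. User $j$ estimates the two messages intended for it by $g_j\big(y_j^n,(m_{jk})_{k\ne j}\big)$. The users and the relay obey the power constraint $\frac1n\sum_{i=1}^n\mathbb{E}[X_i^2]\le P$. An error occurs if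 some user estimates one of its two messages wrongly. The tuple $\vec R$ is achievable if there is a sequence of such codes of rate $\vec R$ and length $n$, $n\to\infty$, whose average error probability tends to $0$. The sum-capacity $C_R$ is the supremum of $\sum_{j\neq k}R_{jk}$ over all achievable tuples. **Theorem.** 1. Every achievable $\vec R$ satisfies, for all distinct $j,k,l\in\{1,2,3\}$, $$R_{kj}+R_{lj}+R_{kl}\le C\big((h_k^2+h_l^2)P\big)\quad\text{and}\quad R_{kj}+R_{lj}+R_{kl}\le C\big((h_j^2+h_l^2)P\big).$$ 2. If $h_1^2\ge h_2^2\ge h_3^2$, then $C_R\le 2\,C\big((h_2^2+h_3^2)P\big)$. -/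

import Mathlib

/-!
Fix distinct users `j`, `k`, `l`. The messages of `j` and the sequence received by `j` yield the
messages intended for `j`; together with the message from `l` to `k` they contain both messages of
`l`, so that the decoder of `l` can be applied as well, and then all six messages are known. Hence,
given the received sequences and the messages of `j`, a correct decision is compatible with at most
one in `K` of the message tuples, where `log₂ K` is about `n (R_kj + R_lj + R_kl)`.

For a Gaussian channel with gains `a` let `f(y|x)` be the density of the output given the input and
`g` the output density for independent Gaussian inputs of variance `P`. Since `∫ g = 1` and the
slices of the success event `D` have probability at most `1 / K`, the integral of
`exp (1_D log K + log g)` is at most `2`, and Jensen's inequality under the true joint law gives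
`P(D) log K ≤ E[log (f / g)] + log 2`. The power constraint bounds the expectation by
`(n / 2) log (1 + |a|² P)`.

This is applied to the channel from `k` and `l` to the relay and to the one from the relay to `j`
and `l`. In the first, centring one of the two independent codewords costs no power and makes the
cross term vanish from the power of their superposition. The sum rate splits into one triple bounded
by the first channel and one bounded by the second.
-/

open MeasureTheory ProbabilityTheory Filter Topology

namespace YChannel

noncomputable section

/-- Rates (or any real data) attached to the six ordered pairs of distinct users:
`R j ⟨k, _⟩` is the rate of the message from user `j` to user `k`. Users are `0, 1, 2`. -/
abbrev RateTuple : Type := (j : Fin 3) → {k : Fin 3 // k ≠ j} → ℝ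

/-- The sum of all six rates. -/
def sumRate (R : RateTuple) : ℝ := ∑ j, ∑ k, R j k

/-- The number of messages `m` with `1 ≤ m ≤ 2 ^ (n r)`. -/
def msgCount (n : ℕ) (r : ℝ) : ℕ := ⌊(2 : ℝ) ^ ((n : ℝ) * r)⌋₊

/-- The pair of messages that user `j` sends. -/
abbrev Own (R : RateTuple) (n : ℕ) (j : Fin 3) : Type :=
  (k : {k : Fin 3 // k ≠ j}) → Fin (msgCount n (R j k))

/-- All six messages. -/
abbrev Messages (R : RateTuple) (n : ℕ) : Type := (j : Fin 3) → Own R n j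

/-- The pair of messages that are intended for user `j`. -/
abbrev Wanted (R : RateTuple) (n : ℕ) (j : Fin 3) : Type :=
  (k : {k : Fin 3 // k ≠ j}) → Fin (msgCount n (R k.1 ⟨j, k.2.symm⟩))

/-- The components of `m` that are intended for user `j`. -/
def wanted {R : RateTuple} {n : ℕ} (m : Messages R n) (j : Fin 3) : Wanted R n j :=
  fun k => m k.1 ⟨j, k.2.symm⟩

/-- The sample space: the six messages, the noise at the relay, the noises at the users. -/
abbrev Outcome (R : RateTuple) (n : ℕ) : Type :=
  Messages R n × (Fin n → ℝ) × (Fin 3 → Fin n → ℝ)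

/-- The law of the messages and noises: the messages are uniform (so the six of them are mutually
independent), all noise samples are standard Gaussian, and everything is independent. -/
def law (R : RateTuple) (n : ℕ) : Measure (Outcome R n) :=
  (uniformOn (Set.univ : Set (Messages R n))).prod
    ((Measure.pi fun _ : Fin n => gaussianReal 0 1).prod
      (Measure.pi fun _ : Fin 3 => Measure.pi fun _ : Fin n => gaussianReal 0 1))

/-- The encoders and decoders of a code of rate `R` and length `n` with restricted encoding: the
codeword of user `j` depends on the two messages of user `j` only. The relay's `i`-th symbol is a
function of the symbols it received strictly before time `i`. -/
structure Code (R : RateTuple) (n : ℕ) where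
  /-- the encoder of user `j` -/
  enc : (j : Fin 3) → Own R n j → Fin n → ℝ
  /-- the relay's encoder at time `i` -/
  relay : (i : Fin n) → (Fin i → ℝ) → ℝ
  /-- the decoder of user `j`, applied to its received sequence and its own messages -/
  dec : (j : Fin 3) → (Fin n → ℝ) → Own R n j → Wanted R n j
  measurable_relay : ∀ i, Measurable (relay i)
  measurable_dec : ∀ j m, Measurable fun y => dec j y m

namespace Code

variable {R : RateTuple} {n : ℕ} (c : Code R n) (h : Fin 3 → ℝ)

/-- The symbol sent by user `j` at time `i`. -/
def userSignal (j : Fin 3) (i : Fin n) (ω : Outcome R n) : ℝ := c.enc j (ω.1 j) i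

/-- The symbol received by the relay at time `i`. -/
def relayReceived (i : Fin n) (ω : Outcome R n) : ℝ :=
  ∑ j, h j * c.userSignal j i ω + ω.2.1 i

/-- The symbol sent by the relay at time `i`. -/
def relaySignal (i : Fin n) (ω : Outcome R n) : ℝ :=
  c.relay i fun t => c.relayReceived h (Fin.castLE i.isLt.le t) ω

/-- The symbol received by user `j` at time `i`. -/
def userReceived (j : Fin 3) (i : Fin n) (ω : Outcome R n) : ℝ :=
  h j * c.relaySignal h i ω + ω.2.2 j i

/-- The event that some user decodes its two messages wrongly. -/
def errorEvent : Set (Outcome R n) :=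
  {ω | ∃ j, c.dec j (fun i => c.userReceived h j i ω) (ω.1 j) ≠ wanted ω.1 j}

/-- The average error probability. -/
def errorProb : ℝ := (law R n).real (c.errorEvent h)

end Code

/-- The average power constraint `(1/n) ∑ᵢ E[Xᵢ²] ≤ P` (all second moments being finite). -/
def PowerConstraint {R : RateTuple} {n : ℕ} (P : ℝ) (X : Fin n → Outcome R n → ℝ) : Prop :=
  (∀ i, Integrable (fun ω => X i ω ^ 2) (law R n)) ∧
    1 / (n : ℝ) * ∑ i, ∫ ω, X i ω ^ 2 ∂(law R n) ≤ P

/-- The users and the relay obey the power constraint `P`. -/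
def Code.IsAdmissible {R : RateTuple} {n : ℕ} (c : Code R n) (h : Fin 3 → ℝ) (P : ℝ) : Prop :=
  (∀ j, PowerConstraint P (c.userSignal j)) ∧ PowerConstraint P (c.relaySignal h)

/-- The capacity region of the restricted Y-channel with gains `h` and power `P`: the set of
achievable rate tuples. -/
def capacityRegion (h : Fin 3 → ℝ) (P : ℝ) : Set RateTuple :=
  {R | (∀ j k, 0 ≤ R j k) ∧ ∃ c : (n : ℕ) → Code R n,
    (∀ n, (c n).IsAdmissible h P) ∧ Tendsto (fun n => (c n).errorProb h) atTop (𝓝 0)}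

/-- The sum-capacity of the restricted Y-channel, as a supremum in the extended reals. -/
def sumCapacity (h : Fin 3 → ℝ) (P : ℝ) : EReal :=
  ⨆ R ∈ capacityRegion h P, (sumRate R : EReal)

/-- `C(x) = (1/2) log₂ (1 + x)`. -/
def gaussCap (x : ℝ) : ℝ := 1 / 2 * Real.logb 2 (1 + x)

end

end YChannel

namespace YChannel

open scoped ENNReal NNReal

section ChangeOfMeasure

variable {ι : Type*} [Fintype ι] {E : ι → Type*} [∀ i, MeasurableSpace (E i)]
  {S Y : Type*} [MeasurableSpace S] [MeasurableSpace Y]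

theorem lintegral_pi_prod (μ : ∀ i, Measure (E i)) [∀ i, IsProbabilityMeasure (μ i)]
    {f : ∀ i, E i → ℝ≥0∞} (hf : ∀ i, Measurable (f i)) :
    ∫⁻ x, ∏ i, f i (x i) ∂Measure.pi μ = ∏ i, ∫⁻ x, f i x ∂μ i := by
  rw [lintegral_prod_eq_prod_lintegral_of_indepFun Finset.univ (fun i (x : ∀ i, E i) => f i (x i))
    (iIndepFun_pi fun i => (hf i).aemeasurable) fun i => (hf i).comp (measurable_pi_apply i)]
  exact Finset.prod_congr rfl fun i _ => (measurePreserving_eval μ i).lintegral_comp (hf i)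

theorem pi_eq_withDensity_prod (μ ν : ∀ i, Measure (E i)) [∀ i, IsProbabilityMeasure (μ i)]
    [∀ i, SigmaFinite (ν i)] {f : ∀ i, E i → ℝ≥0∞} (hf : ∀ i, Measurable (f i))
    (hν : ∀ i, ν i = (μ i).withDensity (f i)) :
    Measure.pi ν = (Measure.pi μ).withDensity fun x => ∏ i, f i (x i) := by
  refine Measure.pi_eq fun t ht => ?_
  have indicator_prod : (Set.univ.pi t).indicator (fun x => ∏ i, f i (x i))
      = fun x => ∏ i, (t i).indicator (f i) (x i) := by
    ext x
    by_cases hx : ∀ i, x i ∈ t i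
    · rw [Set.indicator_of_mem (by simpa using hx)]
      exact Finset.prod_congr rfl fun i _ => (Set.indicator_of_mem (hx i) _).symm
    · obtain ⟨i, hi⟩ := not_forall.1 hx
      rw [Set.indicator_of_notMem (by simpa using hx)]
      exact (Finset.prod_eq_zero (Finset.mem_univ i) (Set.indicator_of_notMem hi _)).symm
  rw [withDensity_apply _ (MeasurableSet.univ_pi ht),
    ← lintegral_indicator (MeasurableSet.univ_pi ht), indicator_prod,
    lintegral_pi_prod μ fun i => (hf i).indicator (ht i)]
  exact Finset.prod_congr rfl fun i _ => by
    rw [lintegral_indicator (ht i), hν i, withDensity_apply _ (ht i)]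

theorem integral_sub_le_of_lintegral_exp_le {ρ ν : Measure S} [IsProbabilityMeasure ν]
    {f g : S → ℝ} {C : ℝ} (hf : Measurable f) (hg : Measurable g)
    (hν : ν = ρ.withDensity fun x => ENNReal.ofReal (Real.exp (f x)))
    (hint : Integrable (fun x => g x - f x) ν)
    (hC : ∫⁻ x, ENNReal.ofReal (Real.exp (g x)) ∂ρ ≤ ENNReal.ofReal (Real.exp C)) :
    ∫ x, g x - f x ∂ν ≤ C := by
  have lintegral_eq : ∫⁻ x, ENNReal.ofReal (Real.exp (g x - f x)) ∂ν
      = ∫⁻ x, ENNReal.ofReal (Real.exp (g x)) ∂ρ := by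
    rw [hν, lintegral_withDensity_eq_lintegral_mul _ (by fun_prop) (by fun_prop)]
    refine lintegral_congr fun x => ?_
    rw [Pi.mul_apply, ← ENNReal.ofReal_mul (Real.exp_pos _).le, ← Real.exp_add, add_sub_cancel]
  have exp_integrable : Integrable (fun x => Real.exp (g x - f x)) ν :=
    ⟨by fun_prop, (hasFiniteIntegral_iff_ofReal (ae_of_all _ fun _ => (Real.exp_pos _).le)).2
      (lintegral_eq ▸ hC.trans_lt ENNReal.ofReal_lt_top)⟩
  refine Real.exp_le_exp.1 ?_
  calc Real.exp (∫ x, g x - f x ∂ν) ≤ ∫ x, Real.exp (g x - f x) ∂ν :=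
        convexOn_exp.map_integral_le Real.continuous_exp.continuousOn isClosed_univ
          (ae_of_all _ fun _ => Set.mem_univ _) hint exp_integrable
    _ ≤ Real.exp C := by
        rw [integral_eq_lintegral_of_nonneg_ae (ae_of_all _ fun _ => (Real.exp_pos _).le)
          exp_integrable.1, lintegral_eq]
        exact ENNReal.toReal_le_of_le_ofReal (Real.exp_pos _).le hC

theorem lintegral_exp_indicator_add_le {μ : Measure S} [IsProbabilityMeasure μ] {γ : Measure Y}
    [SFinite γ] {D : Set (S × Y)} (hD : MeasurableSet D) {K : ℝ} (hK : 0 < K)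
    (hslice : ∀ y, μ {s | (s, y) ∈ D} ≤ ENNReal.ofReal (1 / K)) {L : Y → ℝ} (hL : Measurable L) :
    ∫⁻ p, ENNReal.ofReal (Real.exp (D.indicator (fun _ => Real.log K) p + L p.2)) ∂μ.prod γ
      ≤ 2 * ∫⁻ y, ENNReal.ofReal (Real.exp (L y)) ∂γ := by
  have exp_indicator_le (p : S × Y) : ENNReal.ofReal
      (Real.exp (D.indicator (fun _ => Real.log K) p + L p.2))
      ≤ ENNReal.ofReal (Real.exp (L p.2)) * (1 + ENNReal.ofReal K * D.indicator 1 p) := by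
    rw [add_comm, Real.exp_add, ENNReal.ofReal_mul (Real.exp_pos _).le]
    gcongr
    by_cases hp : p ∈ D <;> simp [hp, Real.exp_log hK]
  have slice_le (y : Y) : ∫⁻ s, (1 + ENNReal.ofReal K * D.indicator 1 (s, y)) ∂μ ≤ 2 := by
    have hDy : MeasurableSet {s | (s, y) ∈ D} := measurable_prodMk_right hD
    have indicator_slice (s : S) :
        D.indicator (1 : S × Y → ℝ≥0∞) (s, y) = {s | (s, y) ∈ D}.indicator 1 s := rfl
    calc ∫⁻ s, (1 + ENNReal.ofReal K * D.indicator 1 (s, y)) ∂μ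
        = 1 + ENNReal.ofReal K * μ {s | (s, y) ∈ D} := by
          simp_rw [indicator_slice]
          rw [lintegral_add_left measurable_const, lintegral_const_mul _
            (measurable_one.indicator hDy), lintegral_indicator_one hDy, lintegral_one,
            measure_univ]
      _ ≤ 1 + ENNReal.ofReal K * ENNReal.ofReal (1 / K) := by
          gcongr
          exact hslice y
      _ = 2 := by
          rw [← ENNReal.ofReal_mul hK.le, mul_one_div_cancel hK.ne', ENNReal.ofReal_one,
            one_add_one_eq_two]
  have : Measurable (D.indicator (1 : S × Y → ℝ≥0∞)) := measurable_one.indicator hD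
  calc _ ≤ _ := lintegral_mono exp_indicator_le
    _ = ∫⁻ y, ENNReal.ofReal (Real.exp (L y))
          * ∫⁻ s, (1 + ENNReal.ofReal K * D.indicator 1 (s, y)) ∂μ ∂γ := by
        rw [lintegral_prod_symm' _ (by fun_prop)]
        exact lintegral_congr fun y =>
          lintegral_const_mul' (ENNReal.ofReal (Real.exp (L y))) _ ENNReal.ofReal_ne_top
    _ ≤ ∫⁻ y, ENNReal.ofReal (Real.exp (L y)) * 2 ∂γ := by gcongr with y; exact slice_le y
    _ = _ := by rw [lintegral_mul_const _ (by fun_prop), mul_comm]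

end ChangeOfMeasure

section GaussianIntegrals

theorem gaussianReal_eq_withDensity_exp (x : ℝ) :
    gaussianReal x 1 = (gaussianReal 0 1).withDensity
      fun z => ENNReal.ofReal (Real.exp (x * z - x ^ 2 / 2)) := by
  rw [gaussianReal_of_var_ne_zero _ one_ne_zero, gaussianReal_of_var_ne_zero _ one_ne_zero,
    ← withDensity_mul _ (measurable_gaussianPDF 0 1) (by fun_prop)]
  congr 1 with z
  simp only [Pi.mul_apply, gaussianPDF_def, gaussianPDFReal_def, NNReal.coe_one]
  rw [← ENNReal.ofReal_mul (by positivity), mul_assoc (_⁻¹), ← Real.exp_add]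
  ring_nf

theorem gaussianPDFReal_mul_exp_quadratic {s : ℝ} (hs : 0 ≤ s) {P v : ℝ≥0} (hP : P ≠ 0)
    (hv : (v : ℝ) = P / (1 + s * P)) (w x : ℝ) :
    gaussianPDFReal 0 P x * Real.exp (x * w - s * x ^ 2 / 2)
      = Real.exp (P * w ^ 2 / (2 * (1 + s * P)) - 1 / 2 * Real.log (1 + s * P))
        * gaussianPDFReal (w * v) v x := by
  have : (0 : ℝ) < P := by positivity
  have h1 : 0 < 1 + s * (P : ℝ) := by positivity
  have exp_log : Real.exp (1 / 2 * Real.log (1 + s * P)) = √(1 + s * P) := by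
    rw [Real.sqrt_eq_rpow, Real.rpow_def_of_pos h1, mul_comm]
  have sqrt_v : √(2 * Real.pi * v) = √(2 * Real.pi * P) / √(1 + s * P) := by
    rw [hv, ← mul_div_assoc, Real.sqrt_div (by positivity)]
  have exponents : P * w ^ 2 / (2 * (1 + s * P)) + -(x - w * v) ^ 2 / (2 * v)
      = -(x - 0) ^ 2 / (2 * P) + (x * w - s * x ^ 2 / 2) := by
    rw [hv]
    field_simp
    ring
  have : √(1 + s * (P : ℝ)) ≠ 0 := (Real.sqrt_pos.2 h1).ne'
  simp only [gaussianPDFReal_def]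
  rw [mul_assoc, ← Real.exp_add, ← exponents, Real.exp_add, Real.exp_sub, exp_log, sqrt_v]
  field_simp

theorem lintegral_exp_quadratic_gaussianReal {s : ℝ} (hs : 0 ≤ s) (P : ℝ≥0) (w : ℝ) :
    ∫⁻ x, ENNReal.ofReal (Real.exp (x * w - s * x ^ 2 / 2)) ∂gaussianReal 0 P
      = ENNReal.ofReal
          (Real.exp (P * w ^ 2 / (2 * (1 + s * P)) - 1 / 2 * Real.log (1 + s * P))) := by
  rcases eq_or_ne P 0 with rfl | hP
  · simp
  obtain ⟨v, hv⟩ : ∃ v : ℝ≥0, (v : ℝ) = P / (1 + s * P) := ⟨⟨P / (1 + s * P), by positivity⟩, rfl⟩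
  have hv0 : v ≠ 0 := by
    rw [← NNReal.coe_ne_zero, hv]
    positivity
  rw [gaussianReal_of_var_ne_zero _ hP,
    lintegral_withDensity_eq_lintegral_mul _ (measurable_gaussianPDF 0 P) (by fun_prop)]
  simp_rw [Pi.mul_apply, gaussianPDF_def]
  simp_rw [← ENNReal.ofReal_mul (gaussianPDFReal_nonneg _ _ _),
    gaussianPDFReal_mul_exp_quadratic hs hP hv w, ENNReal.ofReal_mul (Real.exp_pos _).le]
  rw [lintegral_const_mul _ (by fun_prop), lintegral_gaussianPDFReal_eq_one _ hv0, mul_one]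

end GaussianIntegrals

section GaussianChannel

variable {J T : Type*} {S : Type*} [MeasurableSpace S] {X : S → T → ℝ}

/-- The sequences received when `x` is sent over additive-noise channels with gains `a`, one for
each receiver in `J`, and the noise is `z`. -/
def channelOutput (a : J → ℝ) (x : T → ℝ) (z : J → T → ℝ) : J → T → ℝ :=
  fun j t => a j * x t + z j t

/-- The state of a source together with the channel output when the state `s` is encoded as `X s`
(pairs consist of the state and the noise). -/
def stateAndOutput (a : J → ℝ) (X : S → T → ℝ) (p : S × (J → T → ℝ)) : S × (J → T → ℝ) :=
  (p.1, channelOutput a (X p.1) p.2)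

theorem measurable_channelOutput (a : J → ℝ) (x : T → ℝ) : Measurable (channelOutput a x) := by
  unfold channelOutput
  fun_prop

theorem measurable_stateAndOutput (a : J → ℝ) (hX : Measurable X) :
    Measurable (stateAndOutput a X) := by
  unfold stateAndOutput channelOutput
  fun_prop

variable [Fintype J]

/-- The matched filter of channels with gains `a`: a sufficient statistic for their input. -/
def matchedFilter (a : J → ℝ) (y : J → T → ℝ) (t : T) : ℝ := ∑ j, a j * y j t

@[fun_prop]
theorem measurable_matchedFilter (a : J → ℝ) (t : T) : Measurable fun y => matchedFilter a y t := by
  unfold matchedFilter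
  fun_prop

theorem matchedFilter_channelOutput (a : J → ℝ) (x : T → ℝ) (z : J → T → ℝ) (t : T) :
    matchedFilter a (channelOutput a x z) t = (∑ j, a j ^ 2) * x t + matchedFilter a z t := by
  simp only [matchedFilter, channelOutput, mul_add, Finset.sum_add_distrib, Finset.sum_mul]
  congr 1
  exact Finset.sum_congr rfl fun j _ => by ring

variable [Fintype T] (a : J → ℝ)

/-- The law of standard Gaussian noise, independent across the receivers `J` and the times `T`. -/
noncomputable abbrev gaussianNoise (J T : Type*) [Fintype J] [Fintype T] : Measure (J → T → ℝ) :=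
  Measure.pi fun _ => Measure.pi fun _ => gaussianReal 0 1

/-- The log-density, with respect to the noise, of the channel output given the input `x`. -/
noncomputable def channelLogDensity (x : T → ℝ) (y : J → T → ℝ) : ℝ :=
  ∑ t, (x t * matchedFilter a y t - (∑ j, a j ^ 2) * x t ^ 2 / 2)

/-- The log-density, with respect to the noise, of the channel output when the inputs are
independent centred Gaussians of variance `P`. -/
noncomputable def outputLogDensity (P : ℝ) (y : J → T → ℝ) : ℝ :=
  ∑ t, (P * matchedFilter a y t ^ 2 / (2 * (1 + (∑ j, a j ^ 2) * P))
    - 1 / 2 * Real.log (1 + (∑ j, a j ^ 2) * P))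

theorem measurable_channelLogDensity :
    Measurable fun p : (T → ℝ) × (J → T → ℝ) => channelLogDensity a p.1 p.2 := by
  unfold channelLogDensity matchedFilter
  fun_prop

@[fun_prop]
theorem measurable_outputLogDensity (P : ℝ) :
    Measurable (outputLogDensity a P : (J → T → ℝ) → ℝ) := by
  unfold outputLogDensity
  fun_prop

theorem hasLaw_eval_gaussianNoise (j : J) (t : T) :
    HasLaw (fun z : J → T → ℝ => z j t) (gaussianReal 0 1) (gaussianNoise J T) :=
  ((measurePreserving_eval (fun _ => gaussianReal 0 1) t).comp
    (measurePreserving_eval (fun _ => Measure.pi fun _ => gaussianReal 0 1) j)).hasLaw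

theorem memLp_matchedFilter (t : T) :
    MemLp (fun z => matchedFilter a z t) 2 (gaussianNoise J T) :=
  memLp_finsetSum _ fun j _ => MemLp.const_mul
    ((memLp_id_gaussianReal 2).comp_measurePreserving
      ((hasLaw_eval_gaussianNoise j t).measurePreserving (by fun_prop))) (a j)

theorem integral_matchedFilter (t : T) : ∫ z, matchedFilter a z t ∂gaussianNoise J T = 0 := by
  have centred (j : J) : ∫ z, z j t ∂gaussianNoise J T = 0 := by
    rw [(hasLaw_eval_gaussianNoise j t).integral_eq, integral_id_gaussianReal]
  have noise_integrable (j : J) : Integrable (fun z => z j t) (gaussianNoise J T) :=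
    ((memLp_id_gaussianReal 1).comp_measurePreserving
      ((hasLaw_eval_gaussianNoise j t).measurePreserving (by fun_prop))).integrable le_rfl
  simp only [matchedFilter]
  rw [integral_finsetSum _ fun j _ => (noise_integrable j).const_mul (a j)]
  simp only [integral_const_mul, centred, mul_zero, Finset.sum_const_zero]

theorem integral_matchedFilter_sq (t : T) :
    ∫ z, matchedFilter a z t ^ 2 ∂gaussianNoise J T = ∑ j, a j ^ 2 := by
  have variance_eval : Var[fun w : T → ℝ => w t; Measure.pi fun _ => gaussianReal 0 1] = 1 := by
    rw [(measurePreserving_eval _ t).hasLaw.variance_eq, variance_id_gaussianReal, NNReal.coe_one]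
  have memLp_eval : MemLp (fun w : T → ℝ => w t) 2 (Measure.pi fun _ => gaussianReal 0 1) :=
    (memLp_id_gaussianReal 2).comp_measurePreserving (measurePreserving_eval _ t)
  have variance_sum := variance_sum_pi fun j => memLp_eval.const_mul (a j)
  simp only [variance_const_mul, variance_eval, mul_one] at variance_sum
  rw [← variance_of_integral_eq_zero (memLp_matchedFilter a t).1.aemeasurable
    (integral_matchedFilter a t), ← variance_sum]
  congr 1 with z
  simp only [matchedFilter, Finset.sum_apply]

theorem map_channelOutput_gaussianNoise_eq_pi (x : T → ℝ) :
    (gaussianNoise J T).map (channelOutput a x)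
      = Measure.pi fun j => Measure.pi fun t => gaussianReal (a j * x t) 1 := by
  have shift (j : J) (t : T) : (gaussianReal 0 1).map (fun z => a j * x t + z)
      = gaussianReal (a j * x t) 1 := by
    rw [gaussianReal_map_const_add, zero_add]
  have measurable_shift (j : J) : Measurable fun (w : T → ℝ) t => a j * x t + w t := by fun_prop
  have (j : J) (t : T) : IsProbabilityMeasure ((gaussianReal 0 1).map fun z => a j * x t + z) :=
    Measure.isProbabilityMeasure_map (by fun_prop)
  have (j : J) : IsProbabilityMeasure ((Measure.pi fun _ : T => gaussianReal 0 1).map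
      fun w t => a j * x t + w t) :=
    Measure.isProbabilityMeasure_map (measurable_shift j).aemeasurable
  calc (gaussianNoise J T).map (channelOutput a x)
      = Measure.pi fun j => (Measure.pi fun _ : T => gaussianReal 0 1).map
          fun w t => a j * x t + w t :=
        Measure.pi_map_pi (f := fun j (w : T → ℝ) t => a j * x t + w t)
          fun j => (measurable_shift j).aemeasurable
    _ = Measure.pi fun j => Measure.pi fun t => (gaussianReal 0 1).map (fun z => a j * x t + z) :=
        congrArg Measure.pi <| funext fun j =>
          Measure.pi_map_pi (f := fun t z => a j * x t + z) fun t => by fun_prop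
    _ = _ := by simp_rw [shift]

theorem ofReal_exp_channelLogDensity (x : T → ℝ) (y : J → T → ℝ) :
    ENNReal.ofReal (Real.exp (channelLogDensity a x y))
      = ∏ j, ∏ t, ENNReal.ofReal (Real.exp (a j * x t * y j t - (a j * x t) ^ 2 / 2)) := by
  simp_rw [← ENNReal.ofReal_prod_of_nonneg fun _ _ => (Real.exp_pos _).le, ← Real.exp_sum]
  rw [← ENNReal.ofReal_prod_of_nonneg fun _ _ => (Real.exp_pos _).le, ← Real.exp_sum,
    Finset.sum_comm]
  simp only [channelLogDensity, matchedFilter, Finset.mul_sum, Finset.sum_mul, Finset.sum_div,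
    ← Finset.sum_sub_distrib]
  congr! 4
  ring

theorem map_channelOutput_gaussianNoise (x : T → ℝ) :
    (gaussianNoise J T).map (channelOutput a x)
      = (gaussianNoise J T).withDensity
          fun y => ENNReal.ofReal (Real.exp (channelLogDensity a x y)) := by
  have density (j : J) := pi_eq_withDensity_prod (fun _ : T => gaussianReal 0 1)
    (fun t => gaussianReal (a j * x t) 1)
    (f := fun t z => ENNReal.ofReal (Real.exp (a j * x t * z - (a j * x t) ^ 2 / 2)))
    (by fun_prop) fun t => gaussianReal_eq_withDensity_exp (a j * x t)
  rw [map_channelOutput_gaussianNoise_eq_pi]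
  simp_rw [ofReal_exp_channelLogDensity]
  exact pi_eq_withDensity_prod (fun _ : J => Measure.pi fun _ : T => gaussianReal 0 1) _
    (f := fun j w => ∏ t, ENNReal.ofReal (Real.exp (a j * x t * w t - (a j * x t) ^ 2 / 2)))
    (fun j => by fun_prop) density

theorem map_stateAndOutput (μ : Measure S) (hX : Measurable X) :
    (μ.prod (gaussianNoise J T)).map (stateAndOutput a X)
      = (μ.prod (gaussianNoise J T)).withDensity
          fun p => ENNReal.ofReal (Real.exp (channelLogDensity a (X p.1) p.2)) := by
  have measurable_density : Measurable fun p : S × (J → T → ℝ) =>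
      ENNReal.ofReal (Real.exp (channelLogDensity a (X p.1) p.2)) := by
    have := measurable_channelLogDensity (T := T) a
    fun_prop
  have measurable_out := measurable_stateAndOutput a hX
  refine Measure.ext_of_lintegral _ fun f hf => ?_
  rw [lintegral_map hf measurable_out,
    lintegral_withDensity_eq_lintegral_mul _ measurable_density hf,
    lintegral_prod _ (by fun_prop), lintegral_prod _ (by fun_prop)]
  refine lintegral_congr fun s => ?_
  have measurable_slice : Measurable fun y => f (s, y) := by fun_prop
  calc ∫⁻ z, f (stateAndOutput a X (s, z)) ∂gaussianNoise J T
      = ∫⁻ y, f (s, y) ∂(gaussianNoise J T).map (channelOutput a (X s)) :=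
        (lintegral_map measurable_slice (measurable_channelOutput a (X s))).symm
    _ = _ := by
        rw [map_channelOutput_gaussianNoise]
        exact lintegral_withDensity_eq_lintegral_mul _
          (measurable_density.comp measurable_prodMk_left) measurable_slice

theorem lintegral_exp_channelLogDensity (x : T → ℝ) :
    ∫⁻ y, ENNReal.ofReal (Real.exp (channelLogDensity a x y)) ∂gaussianNoise J T = 1 := by
  have : IsProbabilityMeasure ((gaussianNoise J T).map (channelOutput a x)) :=
    Measure.isProbabilityMeasure_map (measurable_channelOutput a x).aemeasurable
  rw [← setLIntegral_univ, ← withDensity_apply _ MeasurableSet.univ,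
    ← map_channelOutput_gaussianNoise, measure_univ]

theorem lintegral_exp_channelLogDensity_gaussianReal (P : ℝ≥0) (y : J → T → ℝ) :
    ∫⁻ x, ENNReal.ofReal (Real.exp (channelLogDensity a x y))
        ∂Measure.pi (fun _ => gaussianReal 0 P)
      = ENNReal.ofReal (Real.exp (outputLogDensity a P y)) := by
  simp_rw [channelLogDensity, outputLogDensity, Real.exp_sum,
    ENNReal.ofReal_prod_of_nonneg fun _ _ => (Real.exp_pos _).le,
    ← lintegral_exp_quadratic_gaussianReal (Finset.sum_nonneg fun j _ => sq_nonneg (a j)) P]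
  exact lintegral_pi_prod _ (f := fun t x => ENNReal.ofReal
    (Real.exp (x * matchedFilter a y t - (∑ j, a j ^ 2) * x ^ 2 / 2))) (by fun_prop)

theorem lintegral_exp_outputLogDensity (P : ℝ≥0) :
    ∫⁻ y, ENNReal.ofReal (Real.exp (outputLogDensity a P y)) ∂gaussianNoise J T = 1 := by
  have := measurable_channelLogDensity (T := T) a
  simp_rw [← lintegral_exp_channelLogDensity_gaussianReal]
  rw [lintegral_lintegral_swap (by unfold Function.uncurry; fun_prop)]
  simp only [lintegral_exp_channelLogDensity, lintegral_one, measure_univ]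

/-- The information density `log (dP_{Y|X=x}/dP_Y)` of the channel with gains `a`, where the output
law `P_Y` is that of independent centred Gaussian inputs of variance `P`. -/
noncomputable def informationDensity (P : ℝ) (x : T → ℝ) (y : J → T → ℝ) : ℝ :=
  channelLogDensity a x y - outputLogDensity a P y

theorem measurable_informationDensity (P : ℝ) (hX : Measurable X) :
    Measurable fun p : S × (J → T → ℝ) => informationDensity a P (X p.1) p.2 :=
  ((measurable_channelLogDensity a).comp (hX.prodMap measurable_id)).sub
    ((measurable_outputLogDensity a P).comp measurable_snd)

theorem informationDensity_channelOutput {P : ℝ} (hP : 0 ≤ P) (x : T → ℝ) (z : J → T → ℝ) :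
    informationDensity a P x (channelOutput a x z)
      = ∑ t, (1 / (1 + (∑ j, a j ^ 2) * P) * (x t * matchedFilter a z t)
        + (∑ j, a j ^ 2) / (2 * (1 + (∑ j, a j ^ 2) * P)) * x t ^ 2
        - P / (2 * (1 + (∑ j, a j ^ 2) * P)) * matchedFilter a z t ^ 2
        + 1 / 2 * Real.log (1 + (∑ j, a j ^ 2) * P)) := by
  have : 0 ≤ ∑ j, a j ^ 2 := Finset.sum_nonneg fun j _ => sq_nonneg (a j)
  rw [informationDensity, channelLogDensity, outputLogDensity, ← Finset.sum_sub_distrib]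
  refine Finset.sum_congr rfl fun t _ => ?_
  rw [matchedFilter_channelOutput]
  field_simp
  ring

variable {μ : Measure S} [IsProbabilityMeasure μ]

theorem integrable_input_mul_matchedFilter (hX : Measurable X)
    (hX2 : ∀ t, Integrable (fun s => X s t ^ 2) μ) (t : T) :
    Integrable (fun p : S × (J → T → ℝ) => X p.1 t * matchedFilter a p.2 t)
      (μ.prod (gaussianNoise J T)) := by
  have input_memLp : MemLp (fun s => X s t) 2 μ :=
    (memLp_two_iff_integrable_sq (by fun_prop)).2 (hX2 t)
  exact (input_memLp.integrable one_le_two).mul_prod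
    ((memLp_matchedFilter a t).integrable one_le_two)

theorem integrable_quadratic_input_matchedFilter (hX : Measurable X)
    (hX2 : ∀ t, Integrable (fun s => X s t ^ 2) μ) (α β γ δ : ℝ) (t : T) :
    Integrable (fun p : S × (J → T → ℝ) => α * (X p.1 t * matchedFilter a p.2 t)
      + β * X p.1 t ^ 2 - γ * matchedFilter a p.2 t ^ 2 + δ) (μ.prod (gaussianNoise J T)) :=
  ((((integrable_input_mul_matchedFilter a hX hX2 t).const_mul α).add
    (((hX2 t).comp_fst _).const_mul β)).sub
    (((memLp_matchedFilter a t).integrable_sq.comp_snd μ).const_mul γ)).add (integrable_const δ)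

theorem integral_quadratic_input_matchedFilter (hX : Measurable X)
    (hX2 : ∀ t, Integrable (fun s => X s t ^ 2) μ) (α β γ δ : ℝ) (t : T) :
    ∫ p : S × (J → T → ℝ), (α * (X p.1 t * matchedFilter a p.2 t)
      + β * X p.1 t ^ 2 - γ * matchedFilter a p.2 t ^ 2 + δ) ∂μ.prod (gaussianNoise J T)
      = β * ∫ s, X s t ^ 2 ∂μ - γ * ∑ j, a j ^ 2 + δ := by
  have cross : ∫ p : S × (J → T → ℝ), X p.1 t * matchedFilter a p.2 t ∂μ.prod (gaussianNoise J T)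
      = 0 := by
    rw [integral_prod_mul (fun s => X s t) fun z => matchedFilter a z t, integral_matchedFilter,
      mul_zero]
  have cross_integrable := (integrable_input_mul_matchedFilter a hX hX2 t).const_mul α
  have input_integrable := ((hX2 t).comp_fst (gaussianNoise J T)).const_mul β
  have noise_integrable := ((memLp_matchedFilter a t).integrable_sq.comp_snd μ).const_mul γ
  have signal_integrable : Integrable (fun p : S × (J → T → ℝ) =>
      α * (X p.1 t * matchedFilter a p.2 t) + β * X p.1 t ^ 2) (μ.prod (gaussianNoise J T)) :=
    cross_integrable.add input_integrable
  rw [integral_add (signal_integrable.sub' noise_integrable) (integrable_const δ),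
    integral_sub signal_integrable noise_integrable, integral_add cross_integrable input_integrable]
  simp only [integral_const_mul, cross, integral_fun_fst (fun s => X s t ^ 2),
    integral_fun_snd fun z => matchedFilter a z t ^ 2, integral_matchedFilter_sq, integral_const,
    probReal_univ, one_smul, mul_zero, zero_add]

theorem integrable_informationDensity {P : ℝ} (hP : 0 ≤ P) (hX : Measurable X)
    (hX2 : ∀ t, Integrable (fun s => X s t ^ 2) μ) :
    Integrable (fun p => informationDensity a P (X p.1) (channelOutput a (X p.1) p.2))
      (μ.prod (gaussianNoise J T)) := by
  simp_rw [informationDensity_channelOutput a hP]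
  exact integrable_finsetSum _ fun t _ =>
    integrable_quadratic_input_matchedFilter a hX hX2 _ _ _ _ t

theorem integral_informationDensity {P : ℝ} (hP : 0 ≤ P) (hX : Measurable X)
    (hX2 : ∀ t, Integrable (fun s => X s t ^ 2) μ) :
    ∫ p, informationDensity a P (X p.1) (channelOutput a (X p.1) p.2) ∂μ.prod (gaussianNoise J T)
      = Fintype.card T * (1 / 2 * Real.log (1 + (∑ j, a j ^ 2) * P))
        + (∑ j, a j ^ 2) / (2 * (1 + (∑ j, a j ^ 2) * P))
          * (∑ t, ∫ s, X s t ^ 2 ∂μ - Fintype.card T * P) := by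
  simp_rw [informationDensity_channelOutput a hP]
  rw [integral_finsetSum _ fun t _ => integrable_quadratic_input_matchedFilter a hX hX2 _ _ _ _ t]
  simp_rw [integral_quadratic_input_matchedFilter a hX hX2]
  rw [Finset.sum_add_distrib, Finset.sum_sub_distrib, ← Finset.mul_sum, Finset.sum_const,
    Finset.sum_const, Finset.card_univ]
  simp only [nsmul_eq_mul]
  ring

theorem integral_informationDensity_le {P : ℝ} (hP : 0 ≤ P) (hX : Measurable X)
    (hX2 : ∀ t, Integrable (fun s => X s t ^ 2) μ)
    (hXP : ∑ t, ∫ s, X s t ^ 2 ∂μ ≤ Fintype.card T * P) :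
    ∫ p, informationDensity a P (X p.1) (channelOutput a (X p.1) p.2) ∂μ.prod (gaussianNoise J T)
      ≤ Fintype.card T * (1 / 2 * Real.log (1 + (∑ j, a j ^ 2) * P)) := by
  rw [integral_informationDensity a hP hX hX2]
  exact add_le_of_nonpos_right (mul_nonpos_of_nonneg_of_nonpos (by positivity) (sub_nonpos.2 hXP))

theorem integrable_informationDensity_map {P : ℝ} (hP : 0 ≤ P) (hX : Measurable X)
    (hX2 : ∀ t, Integrable (fun s => X s t ^ 2) μ) :
    Integrable (fun p => informationDensity a P (X p.1) p.2)
      ((μ.prod (gaussianNoise J T)).map (stateAndOutput a X)) :=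
  (integrable_map_measure (measurable_informationDensity a P hX).aestronglyMeasurable
    (measurable_stateAndOutput a hX).aemeasurable).2 (integrable_informationDensity a hP hX hX2)

theorem lintegral_exp_indicator_add_outputLogDensity_le {P : ℝ} (hP : 0 ≤ P)
    {D : Set (S × (J → T → ℝ))} (hD : MeasurableSet D) {K : ℝ} (hK : 0 < K)
    (hslice : ∀ y, μ {s | (s, y) ∈ D} ≤ ENNReal.ofReal (1 / K)) :
    ∫⁻ p, ENNReal.ofReal (Real.exp
      (D.indicator (fun _ => Real.log K) p + outputLogDensity a P p.2)) ∂μ.prod (gaussianNoise J T)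
      ≤ ENNReal.ofReal (Real.exp (Real.log 2)) := by
  refine (lintegral_exp_indicator_add_le hD hK hslice (by fun_prop)).trans_eq ?_
  lift P to ℝ≥0 using hP
  rw [lintegral_exp_outputLogDensity, mul_one, Real.exp_log two_pos, ENNReal.ofReal_ofNat]

theorem measureReal_stateAndOutput_mul_log_le {P : ℝ} (hP : 0 ≤ P) (hX : Measurable X)
    (hX2 : ∀ t, Integrable (fun s => X s t ^ 2) μ)
    (hXP : ∑ t, ∫ s, X s t ^ 2 ∂μ ≤ Fintype.card T * P)
    {D : Set (S × (J → T → ℝ))} (hD : MeasurableSet D) {K : ℝ} (hK : 0 < K)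
    (hslice : ∀ y, μ {s | (s, y) ∈ D} ≤ ENNReal.ofReal (1 / K)) :
    (μ.prod (gaussianNoise J T)).real (stateAndOutput a X ⁻¹' D) * Real.log K
      ≤ Fintype.card T * (1 / 2 * Real.log (1 + (∑ j, a j ^ 2) * P)) + Real.log 2 := by
  have measurable_out := measurable_stateAndOutput a hX
  have : IsProbabilityMeasure ((μ.prod (gaussianNoise J T)).map (stateAndOutput a X)) :=
    Measure.isProbabilityMeasure_map measurable_out.aemeasurable
  have indicator_integrable : Integrable (D.indicator fun _ => Real.log K)
      ((μ.prod (gaussianNoise J T)).map (stateAndOutput a X)) :=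
    (integrable_const _).indicator hD
  have information_integrable := integrable_informationDensity_map a hP hX hX2
  have gap (p : S × (J → T → ℝ)) :
      D.indicator (fun _ => Real.log K) p + outputLogDensity a P p.2
        - channelLogDensity a (X p.1) p.2
      = D.indicator (fun _ => Real.log K) p - informationDensity a P (X p.1) p.2 := by
    rw [informationDensity]
    ring
  have gibbs := integral_sub_le_of_lintegral_exp_le
    (f := fun p => channelLogDensity a (X p.1) p.2)
    (g := fun p => D.indicator (fun _ => Real.log K) p + outputLogDensity a P p.2)
    ((measurable_channelLogDensity a).comp (hX.prodMap measurable_id))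
    ((measurable_const.indicator hD).add ((measurable_outputLogDensity a P).comp measurable_snd))
    (map_stateAndOutput a μ hX)
    ((indicator_integrable.sub information_integrable).congr (ae_of_all _ fun p => (gap p).symm))
    (lintegral_exp_indicator_add_outputLogDensity_le a hP hD hK hslice)
  rw [integral_congr_ae (ae_of_all _ gap), integral_sub indicator_integrable information_integrable,
    integral_indicator_const _ hD, map_measureReal_apply measurable_out hD, smul_eq_mul,
    integral_map measurable_out.aemeasurable information_integrable.aestronglyMeasurable] at gibbs
  exact (sub_le_iff_le_add'.1 gibbs).trans
    (add_le_add_left (integral_informationDensity_le a hP hX hX2 hXP) _)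

end GaussianChannel

section Combinatorics

variable {j k l : Fin 3}

theorem eq_or_eq_or_eq_of_distinct (hjk : j ≠ k) (hjl : j ≠ l) (hkl : k ≠ l) (x : Fin 3) :
    x = j ∨ x = k ∨ x = l := by
  omega

@[to_additive]
theorem prod_univ_of_distinct {M : Type*} [CommMonoid M] (hjk : j ≠ k) (hjl : j ≠ l) (hkl : k ≠ l)
    (f : Fin 3 → M) : ∏ x, f x = f j * f k * f l := by
  have : (Finset.univ : Finset (Fin 3)) = {j, k, l} := by
    ext x
    simpa using eq_or_eq_or_eq_of_distinct hjk hjl hkl x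
  rw [this, Finset.prod_insert (by simp [hjk, hjl]), Finset.prod_pair hkl, mul_assoc]

theorem eq_or_eq_of_ne (hjk : j ≠ k) (hjl : j ≠ l) (hkl : k ≠ l) (x : {x : Fin 3 // x ≠ j}) :
    x = ⟨k, hjk.symm⟩ ∨ x = ⟨l, hjl.symm⟩ :=
  ((eq_or_eq_or_eq_of_distinct hjk hjl hkl x).resolve_left x.2).imp Subtype.ext Subtype.ext

@[to_additive]
theorem prod_ne_of_distinct {M : Type*} [CommMonoid M] (hjk : j ≠ k) (hjl : j ≠ l) (hkl : k ≠ l)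
    (f : {x : Fin 3 // x ≠ j} → M) : ∏ x, f x = f ⟨k, hjk.symm⟩ * f ⟨l, hjl.symm⟩ :=
  Fintype.prod_eq_mul _ _ (by simpa using hkl)
    fun x hx => ((eq_or_eq_of_ne hjk hjl hkl x).elim hx.1 hx.2).elim

theorem uniformOn_univ_le_of_injOn {α β : Type*} [Fintype α] [Nonempty α] [MeasurableSpace α]
    [MeasurableSingletonClass α] [Fintype β] {f : α → β} {B : Set α} (hf : Set.InjOn f B) {K : ℕ}
    (hK : Fintype.card α = Fintype.card β * K) :
    uniformOn Set.univ B ≤ ENNReal.ofReal (1 / K) := by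
  have card_pos : 0 < Fintype.card β * K := hK ▸ Fintype.card_pos
  have hβ : (0 : ℝ) < Fintype.card β := by exact_mod_cast pos_of_mul_pos_left card_pos K.zero_le
  have card_le : B.ncard ≤ Fintype.card β := by
    rw [← Nat.card_eq_fintype_card, ← Set.ncard_univ]
    exact Set.ncard_le_ncard_of_injOn f (fun _ _ => Set.mem_univ _) hf
  rw [uniformOn_univ, Measure.count_apply_finite B B.toFinite, ← Set.ncard_eq_toFinset_card B, hK,
    ← ENNReal.ofReal_natCast, ← ENNReal.ofReal_natCast,
    ← ENNReal.ofReal_div_of_pos (by exact_mod_cast card_pos)]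
  refine ENNReal.ofReal_le_ofReal ?_
  calc (B.ncard : ℝ) / (Fintype.card β * K : ℕ)
      ≤ Fintype.card β / (Fintype.card β * K : ℕ) := by gcongr
    _ = 1 / K := by rw [Nat.cast_mul, div_mul_cancel_left₀ hβ.ne', one_div]

end Combinatorics

section Decoding

variable {j k l : Fin 3} {R : RateTuple} {n : ℕ}

/-- The number of values of the three messages from `k` to `j`, from `l` to `j` and from `k` to
`l`. -/
noncomputable def tripleCount (R : RateTuple) (n : ℕ) (hjk : j ≠ k) (hjl : j ≠ l) (hkl : k ≠ l) :
    ℕ :=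
  msgCount n (R k ⟨j, hjk⟩) * msgCount n (R l ⟨j, hjl⟩) * msgCount n (R k ⟨l, hkl.symm⟩)

/-- The event that users `j` and `l` both recover their messages when user `a` receives `y a`. -/
def Code.DecodesPair (c : Code R n) (j l : Fin 3) (m : Messages R n) (y : Fin 3 → Fin n → ℝ) :
    Prop :=
  c.dec j (y j) (m j) = wanted m j ∧ c.dec l (y l) (m l) = wanted m l

theorem card_messages (hjk : j ≠ k) (hjl : j ≠ l) (hkl : k ≠ l) :
    Fintype.card (Messages R n)
      = Fintype.card (Own R n j × Fin (msgCount n (R l ⟨k, hkl⟩)))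
        * tripleCount R n hjk hjl hkl := by
  rw [Fintype.card_prod, Fintype.card_pi, prod_univ_of_distinct hjk hjl hkl]
  simp only [Fintype.card_pi, Fintype.card_fin, tripleCount]
  rw [prod_ne_of_distinct hjk.symm hkl hjl, prod_ne_of_distinct hjl.symm hkl.symm hjk]
  ring

-- User `j` recovers all of `wanted m j`; with `m l ⟨k, _⟩` this gives the own messages of user `l`,
-- whose decoder yields the rest.
theorem Code.DecodesPair.messages_eq {c : Code R n} (hjk : j ≠ k) (hjl : j ≠ l) (hkl : k ≠ l)
    {m m' : Messages R n} {y : Fin 3 → Fin n → ℝ} (hm : c.DecodesPair j l m y)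
    (hm' : c.DecodesPair j l m' y) (hj : m j = m' j) (hlk : m l ⟨k, hkl⟩ = m' l ⟨k, hkl⟩) :
    m = m' := by
  have wanted_j : wanted m j = wanted m' j := by rw [← hm.1, ← hm'.1, hj]
  have hl : m l = m' l := by
    funext x
    rcases eq_or_eq_of_ne hjl.symm hkl.symm hjk x with rfl | rfl
    exacts [congrFun wanted_j ⟨l, hjl.symm⟩, hlk]
  have wanted_l : wanted m l = wanted m' l := by rw [← hm.2, ← hm'.2, hl]
  have hk : m k = m' k := by
    funext x
    rcases eq_or_eq_of_ne hjk.symm hkl hjl x with rfl | rfl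
    exacts [congrFun wanted_j ⟨k, hjk.symm⟩, congrFun wanted_l ⟨k, hkl⟩]
  funext x
  rcases eq_or_eq_or_eq_of_distinct hjk hjl hkl x with rfl | rfl | rfl
  exacts [hj, hk, hl]

theorem one_le_msgCount (n : ℕ) {r : ℝ} (hr : 0 ≤ r) : 1 ≤ msgCount n r :=
  Nat.le_floor (by simpa using Real.one_le_rpow one_le_two (by positivity))

theorem nonempty_own (hR : ∀ a b, 0 ≤ R a b) (a : Fin 3) : Nonempty (Own R n a) :=
  ⟨fun b => ⟨0, one_le_msgCount n (hR a b)⟩⟩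

theorem one_le_tripleCount (hR : ∀ a b, 0 ≤ R a b) (hjk : j ≠ k) (hjl : j ≠ l) (hkl : k ≠ l) :
    1 ≤ tripleCount R n hjk hjl hkl :=
  Nat.mul_pos (Nat.mul_pos (one_le_msgCount n (hR _ _)) (one_le_msgCount n (hR _ _)))
    (one_le_msgCount n (hR _ _))

theorem uniformOn_decodesPair_le (hR : ∀ a b, 0 ≤ R a b) (c : Code R n) (hjk : j ≠ k) (hjl : j ≠ l)
    (hkl : k ≠ l) (y : Own R n j → Fin 3 → Fin n → ℝ) :
    uniformOn (Set.univ : Set (Messages R n)) {m | c.DecodesPair j l m (y (m j))}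
      ≤ ENNReal.ofReal (1 / tripleCount R n hjk hjl hkl) := by
  have := nonempty_own (n := n) hR
  refine uniformOn_univ_le_of_injOn (f := fun m => (m j, m l ⟨k, hkl⟩)) ?_
    (card_messages hjk hjl hkl)
  intro m hm m' hm' hmm'
  obtain ⟨hj, hlk⟩ := Prod.mk.inj hmm'
  exact hm.messages_eq hjk hjl hkl (hj ▸ hm') hj hlk

theorem measurableSet_decodesPair (c : Code R n) (j l : Fin 3) :
    MeasurableSet {p : Messages R n × (Fin 3 → Fin n → ℝ) | c.DecodesPair j l p.1 p.2} := by
  refine measurableSet_setOfPred.2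
    (measurable_from_prod_countable_right fun m => measurableSet_setOfPred.1 ?_)
  have decoder_measurable (a : Fin 3) :
      Measurable fun y : Fin 3 → Fin n → ℝ => c.dec a (y a) (m a) :=
    (c.measurable_dec a (m a)).comp (measurable_pi_apply a)
  exact (decoder_measurable j (measurableSet_singleton (wanted m j))).inter
    (decoder_measurable l (measurableSet_singleton (wanted m l)))

end Decoding

section Probability

variable {R : RateTuple} {n : ℕ}

/-- The uniform law of the six messages. -/
noncomputable abbrev messageLaw (R : RateTuple) (n : ℕ) : Measure (Messages R n) :=
  uniformOn Set.univ

theorem messageLaw_eq_pi (R : RateTuple) (n : ℕ) :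
    messageLaw R n = Measure.pi fun a => uniformOn (Set.univ : Set (Own R n a)) := by
  refine Measure.ext_of_singleton fun m => ?_
  rw [Measure.pi_singleton]
  simp only [uniformOn_univ, Measure.count_singleton, one_div, Fintype.card_pi, Nat.cast_prod]
  exact ENNReal.prod_inv_distrib fun _ _ _ _ _ =>
    Or.inr (ENNReal.prod_ne_top fun _ _ => ENNReal.natCast_ne_top _)

theorem isProbabilityMeasure_messageLaw (hR : ∀ a b, 0 ≤ R a b) :
    IsProbabilityMeasure (messageLaw R n) := by
  have := nonempty_own (n := n) hR
  infer_instance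

theorem indepFun_own_messageLaw (hR : ∀ a b, 0 ≤ R a b) {k l : Fin 3} (hkl : k ≠ l)
    (f : Own R n k → ℝ) (g : Own R n l → ℝ) :
    IndepFun (fun m : Messages R n => f (m k)) (fun m => g (m l)) (messageLaw R n) := by
  have := nonempty_own (n := n) hR
  have independent : iIndepFun (fun a (m : Messages R n) => m a) (messageLaw R n) := by
    rw [messageLaw_eq_pi]
    exact iIndepFun_pi (X := fun _ x => x) fun a => aemeasurable_id
  exact (independent.indepFun hkl).comp (measurable_of_finite f) (measurable_of_finite g)

theorem integral_sq_centred_add_le {Ω : Type*} [MeasurableSpace Ω] {μ : Measure Ω}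
    [IsProbabilityMeasure μ] {U V : Ω → ℝ} (hU : MemLp U 2 μ) (hV : MemLp V 2 μ)
    (hUV : IndepFun U V μ) (u v : ℝ) :
    ∫ ω, (u * (U ω - μ[U]) + v * V ω) ^ 2 ∂μ
      ≤ u ^ 2 * ∫ ω, U ω ^ 2 ∂μ + v ^ 2 * ∫ ω, V ω ^ 2 ∂μ := by
  have centred : MemLp (fun ω => U ω - μ[U]) 2 μ := hU.sub (memLp_const _)
  have independent : IndepFun (fun ω => U ω - μ[U]) V μ :=
    hUV.comp (φ := fun x => x - ∫ ω, U ω ∂μ) (ψ := id) (by fun_prop) measurable_id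
  have cross : ∫ ω, (U ω - μ[U]) * V ω ∂μ = 0 := by
    rw [independent.integral_fun_mul_eq_mul_integral centred.1 hV.1]
    simp [integral_sub (hU.integrable one_le_two)]
  have cross_integrable : Integrable (fun ω => (U ω - μ[U]) * V ω) μ := centred.integrable_mul hV
  have variance_le : ∫ ω, (U ω - μ[U]) ^ 2 ∂μ ≤ ∫ ω, U ω ^ 2 ∂μ := by
    rw [← variance_eq_integral hU.1.aemeasurable]
    exact variance_le_expectation_sq hU.1
  have squares : Integrable (fun ω => u ^ 2 * (U ω - μ[U]) ^ 2 + v ^ 2 * V ω ^ 2) μ :=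
    (centred.integrable_sq.const_mul _).add (hV.integrable_sq.const_mul _)
  calc ∫ ω, (u * (U ω - μ[U]) + v * V ω) ^ 2 ∂μ
      = ∫ ω, (u ^ 2 * (U ω - μ[U]) ^ 2 + v ^ 2 * V ω ^ 2
          + 2 * u * v * ((U ω - μ[U]) * V ω)) ∂μ := by congr with ω; ring
    _ = u ^ 2 * ∫ ω, (U ω - μ[U]) ^ 2 ∂μ + v ^ 2 * ∫ ω, V ω ^ 2 ∂μ := by
        rw [integral_add squares (cross_integrable.const_mul _),
          integral_add (centred.integrable_sq.const_mul _) (hV.integrable_sq.const_mul _)]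
        simp only [integral_const_mul, cross, mul_zero, add_zero]
    _ ≤ _ := by gcongr

theorem prod_le_of_forall_slice_le {M U : Type*} [MeasurableSpace M] [MeasurableSpace U]
    {μ : Measure M} {ν : Measure U} [SFinite μ] [IsProbabilityMeasure ν] {E : Set (M × U)}
    (hE : MeasurableSet E) {b : ℝ≥0∞} (h : ∀ u, μ {m | (m, u) ∈ E} ≤ b) : μ.prod ν E ≤ b := by
  rw [Measure.prod_apply_symm hE]
  exact (lintegral_mono h).trans_eq (by simp only [lintegral_const, measure_univ, mul_one])

theorem measurePreserving_fst_law (hR : ∀ a b, 0 ≤ R a b) :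
    MeasurePreserving Prod.fst (law R n) (messageLaw R n) := by
  have := isProbabilityMeasure_messageLaw (n := n) hR
  exact measurePreserving_fst

theorem measurePreserving_split_law (hR : ∀ a b, 0 ≤ R a b) {U Z : Type*} [MeasurableSpace U]
    [MeasurableSpace Z] {ν : Measure U} {γ : Measure Z} [SFinite ν] [SFinite γ]
    {ψ : (Fin n → ℝ) × (Fin 3 → Fin n → ℝ) → U × Z}
    (hψ : MeasurePreserving ψ ((Measure.pi fun _ => gaussianReal 0 1).prod
      (gaussianNoise (Fin 3) (Fin n))) (ν.prod γ)) :
    MeasurePreserving (fun ω : Outcome R n => ((ω.1, (ψ ω.2).1), (ψ ω.2).2)) (law R n)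
      (((messageLaw R n).prod ν).prod γ) := by
  have := isProbabilityMeasure_messageLaw (n := n) hR
  exact (measurePreserving_prodAssoc _ _ _).symm.comp ((MeasurePreserving.id _).prod hψ)

theorem PowerConstraint.sum_integral_le {P : ℝ} {X : Fin n → Outcome R n → ℝ}
    (hX : PowerConstraint P X) (hn : 0 < n) : ∑ i, ∫ ω, X i ω ^ 2 ∂law R n ≤ n * P := by
  have hn' : (0 : ℝ) < n := by exact_mod_cast hn
  rw [← inv_mul_le_iff₀ hn', ← one_div]
  exact hX.2

theorem one_sub_errorProb_le (hR : ∀ a b, 0 ≤ R a b) (c : Code R n) (h : Fin 3 → ℝ)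
    {W : Type*} [MeasurableSpace W] {μ : Measure W} {φ : Outcome R n → W}
    (hφ : MeasurePreserving φ (law R n) μ) {A : Set W} (hA : MeasurableSet A)
    (hsub : ∀ ω, ω ∉ c.errorEvent h → φ ω ∈ A) : 1 - c.errorProb h ≤ μ.real A := by
  have := isProbabilityMeasure_messageLaw (n := n) hR
  have : IsProbabilityMeasure (law R n) := by
    unfold law
    infer_instance
  rw [← hφ.measureReal_preimage hA.nullMeasurableSet, Code.errorProb, sub_le_iff_le_add,
    ← probReal_univ (μ := law R n)]
  refine (measureReal_mono fun ω _ => ?_).trans (measureReal_union_le _ _)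
  exact (em (ω ∈ c.errorEvent h)).symm.imp (hsub ω) id

end Probability

section FiniteBlocklength

variable {R : RateTuple} {n : ℕ} {j k l : Fin 3}

/-- The sequence that the relay sends when it receives `y`. -/
def Code.broadcast (c : Code R n) (y : Fin n → ℝ) (i : Fin n) : ℝ :=
  c.relay i fun t => y (Fin.castLE i.isLt.le t)

@[fun_prop]
theorem Code.measurable_broadcast (c : Code R n) : Measurable c.broadcast :=
  measurable_pi_lambda _ fun i => (c.measurable_relay i).comp (by fun_prop)

theorem Code.userReceived_eq_channelOutput (c : Code R n) (h : Fin 3 → ℝ) (a : Fin 3)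
    (ω : Outcome R n) : (fun i => c.userReceived h a i ω)
      = channelOutput h (c.broadcast fun t => c.relayReceived h t ω) ω.2.2 a :=
  rfl

/-- The noise is split by `ψ` into a part `U`, which joins the messages to form the source, and the
noise of a Gaussian channel. The hypothesis `hη` says that the output of this channel, `U` and the
messages of user `j` determine what users `j` and `l` receive. -/
theorem one_sub_errorProb_mul_log_tripleCount_le (hR : ∀ a b, 0 ≤ R a b) (c : Code R n)
    (h : Fin 3 → ℝ) (hjk : j ≠ k) (hjl : j ≠ l) (hkl : k ≠ l) {U J : Type*} [MeasurableSpace U]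
    {ν : Measure U} [IsProbabilityMeasure ν] [Fintype J] (a : J → ℝ) {Q : ℝ} (hQ : 0 ≤ Q)
    {ψ : (Fin n → ℝ) × (Fin 3 → Fin n → ℝ) → U × (J → Fin n → ℝ)}
    (hψ : MeasurePreserving ψ ((Measure.pi fun _ => gaussianReal 0 1).prod
      (gaussianNoise (Fin 3) (Fin n))) (ν.prod (gaussianNoise J (Fin n))))
    {X : Messages R n × U → Fin n → ℝ} (hX : Measurable X)
    (hX2 : ∀ i, Integrable (fun s => X s i ^ 2) ((messageLaw R n).prod ν))
    (hXQ : ∑ i, ∫ s, X s i ^ 2 ∂(messageLaw R n).prod ν ≤ n * Q)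
    {η : Own R n j × U × (J → Fin n → ℝ) → Fin 3 → Fin n → ℝ} (hη_measurable : Measurable η)
    (hη : ∀ ω : Outcome R n, ∀ b, b ≠ k →
      η (ω.1 j, (ψ ω.2).1, channelOutput a (X (ω.1, (ψ ω.2).1)) (ψ ω.2).2) b
        = fun i => c.userReceived h b i ω) :
    (1 - c.errorProb h) * Real.log (tripleCount R n hjk hjl hkl)
      ≤ n * (1 / 2 * Real.log (1 + (∑ i, a i ^ 2) * Q)) + Real.log 2 := by
  have := isProbabilityMeasure_messageLaw (n := n) hR
  have hK : (1 : ℝ) ≤ tripleCount R n hjk hjl hkl := by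
    exact_mod_cast one_le_tripleCount hR hjk hjl hkl
  let D : Set ((Messages R n × U) × (J → Fin n → ℝ)) :=
    {p | c.DecodesPair j l p.1.1 (η (p.1.1 j, p.1.2, p.2))}
  have hD : MeasurableSet D := measurableSet_decodesPair c j l |>.preimage
    (f := fun p : (Messages R n × U) × (J → Fin n → ℝ) => (p.1.1, η (p.1.1 j, p.1.2, p.2)))
    (by fun_prop)
  have slice_le (y : J → Fin n → ℝ) : (messageLaw R n).prod ν {s | (s, y) ∈ D}
      ≤ ENNReal.ofReal (1 / tripleCount R n hjk hjl hkl) :=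
    prod_le_of_forall_slice_le (measurable_prodMk_right hD) fun u =>
      uniformOn_decodesPair_le hR c hjk hjl hkl fun mj => η (mj, u, y)
  have success_le := one_sub_errorProb_le hR c h (measurePreserving_split_law hR hψ)
    (hD.preimage (measurable_stateAndOutput a hX)) fun ω hω => by
      simp only [Code.errorEvent, Set.mem_ofPred_eq, not_exists, not_not] at hω
      exact ⟨(congrArg (c.dec j · (ω.1 j)) (hη ω j hjk)).trans (hω j),
        (congrArg (c.dec l · (ω.1 l)) (hη ω l hkl.symm)).trans (hω l)⟩
  have converse := measureReal_stateAndOutput_mul_log_le a hQ hX hX2 (by simpa using hXQ) hD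
    (zero_lt_one.trans_le hK) slice_le
  rw [Fintype.card_fin] at converse
  exact (mul_le_mul_of_nonneg_right success_le (Real.log_nonneg hK)).trans converse

/-- The mean of the `i`-th symbol of user `k`. -/
noncomputable def Code.meanSignal (c : Code R n) (k : Fin 3) (i : Fin n) : ℝ :=
  ∫ m, c.enc k (m k) i ∂messageLaw R n

/-- The superposition of the signals of users `k` and `l` at the relay. The signal of user `k` is
centred, so that the cross term of the two independent signals has mean zero. -/
noncomputable def Code.uplinkInput (c : Code R n) (h : Fin 3 → ℝ) (k l : Fin 3)
    (m : Messages R n) (i : Fin n) : ℝ :=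
  h k * (c.enc k (m k) i - c.meanSignal k i) + h l * c.enc l (m l) i

/-- What the relay receives in addition to `Code.uplinkInput` and noise: a function of the messages
of user `j`. -/
noncomputable def Code.uplinkOffset (c : Code R n) (h : Fin 3 → ℝ) (j k : Fin 3)
    (mj : Own R n j) (i : Fin n) : ℝ :=
  h j * c.enc j mj i + h k * c.meanSignal k i

theorem Code.relayReceived_eq_uplinkInput_add (c : Code R n) (h : Fin 3 → ℝ) (hjk : j ≠ k)
    (hjl : j ≠ l) (hkl : k ≠ l) (i : Fin n) (ω : Outcome R n) :
    c.relayReceived h i ω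
      = 1 * c.uplinkInput h k l ω.1 i + ω.2.1 i + c.uplinkOffset h j k (ω.1 j) i := by
  rw [Code.relayReceived, sum_univ_of_distinct hjk hjl hkl, Code.uplinkInput, Code.uplinkOffset]
  simp only [Code.userSignal]
  ring

theorem integral_userSignal_sq (hR : ∀ a b, 0 ≤ R a b) (c : Code R n) (a : Fin 3) (i : Fin n) :
    ∫ ω, c.userSignal a i ω ^ 2 ∂law R n = ∫ m, c.enc a (m a) i ^ 2 ∂messageLaw R n :=
  (measurePreserving_fst_law hR).hasLaw.integral_comp
    (f := fun m => c.enc a (m a) i ^ 2) (measurable_of_finite _).aestronglyMeasurable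

theorem sum_integral_uplinkInput_sq_le (hR : ∀ a b, 0 ≤ R a b) {c : Code R n} {h : Fin 3 → ℝ}
    {P : ℝ} (hc : c.IsAdmissible h P) (hn : 0 < n) (hkl : k ≠ l) :
    ∑ i, ∫ m, c.uplinkInput h k l m i ^ 2 ∂messageLaw R n ≤ n * ((h k ^ 2 + h l ^ 2) * P) := by
  have := isProbabilityMeasure_messageLaw (n := n) hR
  have symbol_le (i : Fin n) : ∫ m, c.uplinkInput h k l m i ^ 2 ∂messageLaw R n
      ≤ h k ^ 2 * ∫ ω, c.userSignal k i ω ^ 2 ∂law R n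
        + h l ^ 2 * ∫ ω, c.userSignal l i ω ^ 2 ∂law R n := by
    rw [integral_userSignal_sq hR, integral_userSignal_sq hR]
    exact integral_sq_centred_add_le MemLp.of_discrete MemLp.of_discrete
      (indepFun_own_messageLaw hR hkl (c.enc k · i) (c.enc l · i)) (h k) (h l)
  calc _ ≤ _ := Finset.sum_le_sum fun i _ => symbol_le i
    _ = h k ^ 2 * ∑ i, ∫ ω, c.userSignal k i ω ^ 2 ∂law R n
        + h l ^ 2 * ∑ i, ∫ ω, c.userSignal l i ω ^ 2 ∂law R n := by
      rw [Finset.sum_add_distrib, Finset.mul_sum, Finset.mul_sum]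
    _ ≤ h k ^ 2 * (n * P) + h l ^ 2 * (n * P) := by
      gcongr
      exacts [(hc.1 k).sum_integral_le hn, (hc.1 l).sum_integral_le hn]
    _ = _ := by ring

theorem measurePreserving_userNoise_relayNoise (n : ℕ) :
    MeasurePreserving (fun z : (Fin n → ℝ) × (Fin 3 → Fin n → ℝ) => (z.2, fun _ : Unit => z.1))
      ((Measure.pi fun _ => gaussianReal 0 1).prod (gaussianNoise (Fin 3) (Fin n)))
      ((gaussianNoise (Fin 3) (Fin n)).prod (gaussianNoise Unit (Fin n))) :=
  ((MeasurePreserving.id _).prod (measurePreserving_funUnique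
    (Measure.pi fun _ : Fin n => gaussianReal 0 1) Unit).symm).comp Measure.measurePreserving_swap

theorem one_sub_errorProb_mul_log_tripleCount_le_uplink (hR : ∀ a b, 0 ≤ R a b)
    (c : Code R n) (h : Fin 3 → ℝ) {P : ℝ} (hP : 0 ≤ P) (hc : c.IsAdmissible h P) (hn : 0 < n)
    (hjk : j ≠ k) (hjl : j ≠ l) (hkl : k ≠ l) :
    (1 - c.errorProb h) * Real.log (tripleCount R n hjk hjl hkl)
      ≤ n * (1 / 2 * Real.log (1 + (h k ^ 2 + h l ^ 2) * P)) + Real.log 2 := by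
  have := isProbabilityMeasure_messageLaw (n := n) hR
  have input_measurable : Measurable (c.uplinkInput h k l) := measurable_of_finite _
  have offset_measurable : Measurable (c.uplinkOffset h j k) := measurable_of_finite _
  have power_le : ∑ i, ∫ s, c.uplinkInput h k l s.1 i ^ 2
      ∂(messageLaw R n).prod (gaussianNoise (Fin 3) (Fin n)) ≤ n * ((h k ^ 2 + h l ^ 2) * P) := by
    refine (Finset.sum_congr rfl fun i _ => ?_).trans_le
      (sum_integral_uplinkInput_sq_le hR hc hn hkl)
    rw [integral_fun_fst fun m => c.uplinkInput h k l m i ^ 2, probReal_univ, one_smul]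
  have bound := one_sub_errorProb_mul_log_tripleCount_le hR c h hjk hjl hkl (fun _ : Unit => 1)
    (Q := (h k ^ 2 + h l ^ 2) * P) (by positivity) (measurePreserving_userNoise_relayNoise n)
    (X := fun s => c.uplinkInput h k l s.1) (input_measurable.comp measurable_fst)
    (fun i => (Integrable.of_finite (f := fun m => c.uplinkInput h k l m i ^ 2)).comp_fst _)
    power_le
    (η := fun q => channelOutput h
      (c.broadcast fun t => q.2.2 () t + c.uplinkOffset h j k q.1 t) q.2.1)
    (by unfold channelOutput; fun_prop)
    (fun ω b _ => by
      simp only [Code.userReceived_eq_channelOutput,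
        Code.relayReceived_eq_uplinkInput_add c h hjk hjl hkl, channelOutput])
  simpa using bound

/-- The symbols sent by the relay, as a function of the messages and the noise at the relay. -/
def Code.downlinkInput (c : Code R n) (h : Fin 3 → ℝ) (s : Messages R n × (Fin n → ℝ)) :
    Fin n → ℝ :=
  c.broadcast fun t => ∑ a, h a * c.enc a (s.1 a) t + s.2 t

theorem Code.measurable_downlinkInput (c : Code R n) (h : Fin 3 → ℝ) :
    Measurable (c.downlinkInput h) := by
  have : Measurable fun (m : Messages R n) t => ∑ a, h a * c.enc a (m a) t :=
    measurable_of_finite _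
  unfold Code.downlinkInput
  fun_prop

theorem PowerConstraint.integrable_and_sum_integral_le {S : Type*} [MeasurableSpace S]
    {μ : Measure S} {P : ℝ} {X : S → Fin n → ℝ} (hX : Measurable X) {φ : Outcome R n → S}
    (hφ : MeasurePreserving φ (law R n) μ) (hP : PowerConstraint P fun i ω => X (φ ω) i)
    (hn : 0 < n) :
    (∀ i, Integrable (fun s => X s i ^ 2) μ) ∧ ∑ i, ∫ s, X s i ^ 2 ∂μ ≤ n * P := by
  have square_measurable (i : Fin n) : AEStronglyMeasurable (fun s => X s i ^ 2) μ := by fun_prop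
  refine ⟨fun i => (hφ.integrable_comp (square_measurable i)).1 (hP.1 i), ?_⟩
  exact (Finset.sum_congr rfl fun i _ =>
    (hφ.hasLaw.integral_comp (square_measurable i)).symm).trans_le (hP.sum_integral_le hn)

theorem one_sub_errorProb_mul_log_tripleCount_le_downlink (hR : ∀ a b, 0 ≤ R a b)
    (c : Code R n) (h : Fin 3 → ℝ) {P : ℝ} (hP : 0 ≤ P) (hc : c.IsAdmissible h P) (hn : 0 < n)
    (hjk : j ≠ k) (hjl : j ≠ l) (hkl : k ≠ l) :
    (1 - c.errorProb h) * Real.log (tripleCount R n hjk hjl hkl)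
      ≤ n * (1 / 2 * Real.log (1 + (h j ^ 2 + h l ^ 2) * P)) + Real.log 2 := by
  have := isProbabilityMeasure_messageLaw (n := n) hR
  have gains : ∑ a, Function.update h k 0 a ^ 2 = h j ^ 2 + h l ^ 2 := by
    rw [sum_univ_of_distinct hjk hjl hkl, Function.update_of_ne hjk,
      Function.update_of_ne hkl.symm, Function.update_self]
    ring
  have source := measurePreserving_fst.comp (measurePreserving_split_law (R := R) hR
    (MeasurePreserving.id ((Measure.pi fun _ : Fin n => gaussianReal 0 1).prod
      (gaussianNoise (Fin 3) (Fin n)))))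
  obtain ⟨square_integrable, power_le⟩ := PowerConstraint.integrable_and_sum_integral_le
    (c.measurable_downlinkInput h) source hc.2 hn
  rw [← gains]
  exact one_sub_errorProb_mul_log_tripleCount_le hR c h hjk hjl hkl (Function.update h k 0) hP
    (MeasurePreserving.id _) (c.measurable_downlinkInput h) square_integrable power_le
    (η := fun q => q.2.2) (by fun_prop)
    (fun ω b hb => by
      funext i
      simp only [Code.userReceived, channelOutput, Function.update_of_ne hb]
      rfl)

end FiniteBlocklength

section Asymptotics

variable {j k l : Fin 3} {R : RateTuple} {h : Fin 3 → ℝ} {P : ℝ}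

theorem sub_one_mul_log_two_le_log_msgCount (n : ℕ) {r : ℝ} (hr : 0 ≤ r) :
    (n * r - 1) * Real.log 2 ≤ Real.log (msgCount n r) := by
  have count_ge_one : (1 : ℝ) ≤ msgCount n r := by exact_mod_cast one_le_msgCount n hr
  have pow_le : (2 : ℝ) ^ (n * r) ≤ 2 * msgCount n r :=
    (Nat.lt_floor_add_one _).le.trans (by rw [← msgCount]; linarith)
  have log_le := Real.log_le_log (by positivity) pow_le
  rw [Real.log_rpow two_pos, Real.log_mul two_ne_zero (by positivity)] at log_le
  linarith

theorem sub_three_mul_log_two_le_log_tripleCount (hR : ∀ a b, 0 ≤ R a b) (n : ℕ) (hjk : j ≠ k)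
    (hjl : j ≠ l) (hkl : k ≠ l) :
    (n * (R k ⟨j, hjk⟩ + R l ⟨j, hjl⟩ + R k ⟨l, hkl.symm⟩) - 3) * Real.log 2
      ≤ Real.log (tripleCount R n hjk hjl hkl) := by
  have count_ne_zero (a : Fin 3) (b : {b : Fin 3 // b ≠ a}) : (msgCount n (R a b) : ℝ) ≠ 0 := by
    exact_mod_cast Nat.one_le_iff_ne_zero.1 (one_le_msgCount n (hR a b))
  rw [tripleCount, Nat.cast_mul, Nat.cast_mul,
    Real.log_mul (mul_ne_zero (count_ne_zero _ _) (count_ne_zero _ _)) (count_ne_zero _ _),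
    Real.log_mul (count_ne_zero _ _) (count_ne_zero _ _)]
  linarith [sub_one_mul_log_two_le_log_msgCount n (hR k ⟨j, hjk⟩),
    sub_one_mul_log_two_le_log_msgCount n (hR l ⟨j, hjl⟩),
    sub_one_mul_log_two_le_log_msgCount n (hR k ⟨l, hkl.symm⟩)]

theorem le_of_one_sub_mul_le_nat_mul_add {ε : ℕ → ℝ} (hε : Tendsto ε atTop (𝓝 0)) {s b t d : ℝ}
    (hbound : ∀ᶠ n : ℕ in atTop, (1 - ε n) * (n * s - b) ≤ n * t + d) : s ≤ t := by
  have lhs_tendsto : Tendsto (fun n : ℕ => (1 - ε n) * (s - b / n)) atTop (𝓝 s) := by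
    simpa using (hε.const_sub 1).mul ((tendsto_const_div_atTop_nhds_zero_nat b).const_sub s)
  have rhs_tendsto : Tendsto (fun n : ℕ => t + d / n) atTop (𝓝 t) := by
    simpa using (tendsto_const_div_atTop_nhds_zero_nat d).const_add t
  refine le_of_tendsto_of_tendsto lhs_tendsto rhs_tendsto ?_
  filter_upwards [eventually_gt_atTop 0, hbound] with n hn bound
  have : (0 : ℝ) < n := by exact_mod_cast hn
  calc (1 - ε n) * (s - b / n) = (1 - ε n) * (n * s - b) / n := by field_simp
    _ ≤ (n * t + d) / n := by gcongr
    _ = t + d / n := by field_simp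

theorem gaussCap_mul_log_two (x : ℝ) : gaussCap x * Real.log 2 = 1 / 2 * Real.log (1 + x) := by
  rw [gaussCap, Real.logb, mul_assoc, div_mul_cancel₀ _ (Real.log_pos one_lt_two).ne']

theorem tripleRate_le_gaussCap (hR : ∀ a b, 0 ≤ R a b) (hjk : j ≠ k) (hjl : j ≠ l) (hkl : k ≠ l)
    {ε : ℕ → ℝ} (hε : Tendsto ε atTop (𝓝 0)) {x : ℝ}
    (hbound : ∀ n : ℕ, 0 < n → (1 - ε n) * Real.log (tripleCount R n hjk hjl hkl)
      ≤ n * (1 / 2 * Real.log (1 + x)) + Real.log 2) :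
    R k ⟨j, hjk⟩ + R l ⟨j, hjl⟩ + R k ⟨l, hkl.symm⟩ ≤ gaussCap x := by
  have log_two_pos := Real.log_pos one_lt_two
  refine le_of_mul_le_mul_right ?_ log_two_pos
  refine le_of_one_sub_mul_le_nat_mul_add hε (b := 3 * Real.log 2) (d := Real.log 2) ?_
  filter_upwards [eventually_gt_atTop 0, hε.eventually_lt_const one_pos] with n hn hεn
  calc _ ≤ (1 - ε n) * Real.log (tripleCount R n hjk hjl hkl) := by
        refine mul_le_mul_of_nonneg_left ?_ (sub_nonneg.2 hεn.le)
        linarith [sub_three_mul_log_two_le_log_tripleCount hR n hjk hjl hkl]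
    _ ≤ _ := hbound n hn
    _ = _ := by rw [gaussCap_mul_log_two]

theorem tripleRate_le_of_mem_capacityRegion (hP : 0 ≤ P) (hR : R ∈ capacityRegion h P)
    (hjk : j ≠ k) (hjl : j ≠ l) (hkl : k ≠ l) :
    R k ⟨j, hjk⟩ + R l ⟨j, hjl⟩ + R k ⟨l, hkl.symm⟩ ≤ gaussCap ((h k ^ 2 + h l ^ 2) * P) ∧
      R k ⟨j, hjk⟩ + R l ⟨j, hjl⟩ + R k ⟨l, hkl.symm⟩ ≤ gaussCap ((h j ^ 2 + h l ^ 2) * P) := by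
  obtain ⟨rates_nonneg, c, admissible, error_tendsto⟩ := hR
  exact ⟨tripleRate_le_gaussCap rates_nonneg hjk hjl hkl error_tendsto fun n hn =>
      one_sub_errorProb_mul_log_tripleCount_le_uplink rates_nonneg (c n) h hP
        (admissible n) hn hjk hjl hkl,
    tripleRate_le_gaussCap rates_nonneg hjk hjl hkl error_tendsto fun n hn =>
      one_sub_errorProb_mul_log_tripleCount_le_downlink rates_nonneg (c n) h hP
        (admissible n) hn hjk hjl hkl⟩

theorem sumRate_eq (R : RateTuple) (hjk : j ≠ k) (hjl : j ≠ l) (hkl : k ≠ l) :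
    sumRate R = (R k ⟨j, hjk⟩ + R l ⟨j, hjl⟩ + R k ⟨l, hkl.symm⟩)
      + (R j ⟨k, hjk.symm⟩ + R l ⟨k, hkl⟩ + R j ⟨l, hjl.symm⟩) := by
  rw [sumRate, sum_univ_of_distinct hjk hjl hkl, sum_ne_of_distinct hjk hjl hkl,
    sum_ne_of_distinct hjk.symm hkl hjl, sum_ne_of_distinct hjl.symm hkl.symm hjk]
  ring

theorem sumRate_le_of_mem_capacityRegion (hP : 0 ≤ P) (hR : R ∈ capacityRegion h P) (hjl : j ≠ l) :
    sumRate R ≤ 2 * gaussCap ((h j ^ 2 + h l ^ 2) * P) := by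
  obtain ⟨i, hij, hil⟩ : ∃ i : Fin 3, i ≠ j ∧ i ≠ l := by
    revert j l
    decide
  rw [sumRate_eq R hij hil hjl]
  linarith [(tripleRate_le_of_mem_capacityRegion hP hR hij hil hjl).1,
    (tripleRate_le_of_mem_capacityRegion hP hR hij.symm hjl hil).2]

end Asymptotics

end YChannel

theorem mainTheorem6_general (h : Fin 3 → ℝ) (P : ℝ) (hP : 0 ≤ P) :
    (∀ R ∈ YChannel.capacityRegion h P, ∀ (j k l : Fin 3) (hjk : j ≠ k) (hjl : j ≠ l) (hkl : k ≠ l),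
      R k ⟨j, hjk⟩ + R l ⟨j, hjl⟩ + R k ⟨l, hkl.symm⟩
          ≤ YChannel.gaussCap ((h k ^ 2 + h l ^ 2) * P) ∧
      R k ⟨j, hjk⟩ + R l ⟨j, hjl⟩ + R k ⟨l, hkl.symm⟩
          ≤ YChannel.gaussCap ((h j ^ 2 + h l ^ 2) * P)) ∧
    ∀ j l, j ≠ l → YChannel.sumCapacity h P
      ≤ ((2 * YChannel.gaussCap ((h j ^ 2 + h l ^ 2) * P) : ℝ) : EReal) :=
  ⟨fun _ hR _ _ _ hjk hjl hkl =>
      YChannel.tripleRate_le_of_mem_capacityRegion hP hR hjk hjl hkl,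
    fun _ _ hjl => iSup₂_le fun _ hR =>
      EReal.coe_le_coe_iff.2 (YChannel.sumRate_le_of_mem_capacityRegion hP hR hjl)⟩

theorem mainTheorem6 (h : Fin 3 → ℝ) (P : ℝ) (hP : 0 ≤ P) :
    (∀ R ∈ YChannel.capacityRegion h P, ∀ (j k l : Fin 3) (hjk : j ≠ k) (hjl : j ≠ l) (hkl : k ≠ l),
      R k ⟨j, hjk⟩ + R l ⟨j, hjl⟩ + R k ⟨l, hkl.symm⟩
          ≤ YChannel.gaussCap ((h k ^ 2 + h l ^ 2) * P) ∧
      R k ⟨j, hjk⟩ + R l ⟨j, hjl⟩ + R k ⟨l, hkl.symm⟩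
          ≤ YChannel.gaussCap ((h j ^ 2 + h l ^ 2) * P)) ∧
    (h 1 ^ 2 ≤ h 0 ^ 2 → h 2 ^ 2 ≤ h 1 ^ 2 →
      YChannel.sumCapacity h P
        ≤ ((2 * YChannel.gaussCap ((h 1 ^ 2 + h 2 ^ 2) * P) : ℝ) : EReal)) :=
  (mainTheorem6_general h P hP).imp id fun sum_le _ _ => sum_le 1 2 (by decide)
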